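/- Let $p$ be a prime and let $A$ be a discrete valuation ring, with maximal ideal $\mathfrak p_A$, whose residue field has characteristic $p$ (neither completeness of $A$ nor perfectness of its residue field is assumed). Let $\mathrm{CRP}_A$ be the full subcategory of the category of (commutative) $A$-algebras consisting of the $A$-algebras $R$ such that $R$ is flat over $A$, $R$ is complete and separated with respect to the ideal $\mathfrak p_A R$, and the reduction $\overline R = R/\mathfrak p_A R$ is perfect, i.e. $x\mapsto x^p$ is a bijection of $\overline R$. The universal residual perfection $A^{\mathrm u}$ of $A$ is the initial object of $\mathrm{CRP}_A$. The generic residual perfection $A^{\mathrm g}$ of $A$ is the object of $\mathrm{CRP}_A$ that corresponds to the fraction field of $\overline{A^{\mathrm u}}$, i.e. the object such that the reduction $\overline{A^{\mathrm u}}\to\overline{A^{\mathrm g}}$ of the unique $A$-algebra map $A^{\mathrm u}\to A^{\mathrm g}$ makes $\overline{A^{\mathrm g}}$ the fraction field of $\overline{A^{\mathrm u}}$. Let $B$ be a finite étale extension of $A$, i.e. a discrete valuation ring with an injective local homomorphism $A\to B$ that is finite and étale. Then there is a unique $A$-algebra map $A^{\mathrm u}\to B^{\mathrm u}$ and a unique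 $A$-algebra map $A^{\mathrm g}\to B^{\mathrm g}$, and the induced maps of $B$-algebras $$B\otimes_A A^{\mathrm u}\longrightarrow B^{\mathrm u}\qquad\text{and}\qquad B\otimes_A A^{\mathrm g}\longrightarrow B^{\mathrm g}$$ are isomorphisms. -/

import Mathlib

open scoped TensorProduct

universe u

namespace ResidualPerfection

/-- The ideal `𝔭_A R` generated in an `A`-algebra `R` by the maximal ideal of the local ring `A`. -/
abbrev residualIdeal (A R : Type*) [CommRing A] [IsLocalRing A] [CommRing R] [Algebra A R] :
    Ideal R :=
  (IsLocalRing.maximalIdeal A).map (algebraMap A R)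

/-- The reduction `R̄ = R / 𝔭_A R` of an `A`-algebra `R`. -/
abbrev Reduction (A R : Type*) [CommRing A] [IsLocalRing A] [CommRing R] [Algebra A R] :=
  R ⧸ residualIdeal A R

theorem residualIdeal_le_comap {A R S : Type*} [CommRing A] [IsLocalRing A] [CommRing R]
    [Algebra A R] [CommRing S] [Algebra A S] (f : R →ₐ[A] S) :
    residualIdeal A R ≤ (residualIdeal A S).comap f.toRingHom := by
  rw [← Ideal.map_le_iff_le_comap, residualIdeal, Ideal.map_map]
  exact le_of_eq (congrArg (fun g => Ideal.map g (IsLocalRing.maximalIdeal A)) f.comp_algebraMap)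

/-- The reduction `R̄ → S̄` of a homomorphism `f : R → S` of `A`-algebras. -/
def reductionMap {A R S : Type*} [CommRing A] [IsLocalRing A] [CommRing R]
    [Algebra A R] [CommRing S] [Algebra A S] (f : R →ₐ[A] S) :
    Reduction A R →+* Reduction A S :=
  Ideal.quotientMap (residualIdeal A S) f.toRingHom (residualIdeal_le_comap f)

/-- `R` is a complete residual perfection of `A`: it is flat over `A`, complete (and separated)
with respect to `𝔭_A R`, and the `p`-th power map of `R / 𝔭_A R` is bijective. These are the
objects of a full subcategory `CRP_A` of the category of `A`-algebras. -/
structure IsCompleteResidualPerfection (p : ℕ) (A R : Type*) [CommRing A] [IsLocalRing A]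
    [CommRing R] [Algebra A R] : Prop where
  flat : Module.Flat A R
  complete : IsAdicComplete (residualIdeal A R) R
  perfect : PerfectRing (Reduction A R) p

/-- `U` is a universal residual perfection `Aᵘ` of `A`: an initial object of `CRP_A`. -/
structure IsUniversalResidualPerfection (p : ℕ) (A U : Type u) [CommRing A] [IsLocalRing A]
    [CommRing U] [Algebra A U] : Prop where
  isCompleteResidualPerfection : IsCompleteResidualPerfection p A U
  initial : ∀ (R : Type u) [CommRing R] [Algebra A R], IsCompleteResidualPerfection p A R →
    ∃! _f : U →ₐ[A] R, True

/-- `G` is a generic residual perfection `Aᵍ` of `A`: the object of `CRP_A` that corresponds to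
the fraction field of the reduction of the universal residual perfection `U` of `A`, that is,
the reduction `Ū → Ḡ` of the unique map `U → G` makes `Ḡ` the fraction field of `Ū`.
`IsFractionRing` means localization at the non-zero-divisors, which is the fraction field because
`Ū` is a domain; that fact is not assumed here. -/
structure IsGenericResidualPerfection (p : ℕ) (A G : Type u) [CommRing A] [IsLocalRing A]
    [CommRing G] [Algebra A G] : Prop where
  isCompleteResidualPerfection : IsCompleteResidualPerfection p A G
  exists_isFractionRing : ∃ (U : Type u) (_ : CommRing U) (_ : Algebra A U) (f : U →ₐ[A] G),
    IsUniversalResidualPerfection p A U ∧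
      letI : Algebra (Reduction A U) (Reduction A G) := (reductionMap f).toAlgebra
      IsFractionRing (Reduction A U) (Reduction A G)

/-- The `B`-algebra map `B ⊗_A R → S`, `b ⊗ r ↦ b φ(r)`, induced by an `A`-algebra map
`φ : R → S` to a `B`-algebra `S`. -/
noncomputable def baseChangeMap {A B R S : Type*} [CommRing A] [CommRing B] [Algebra A B]
    [CommRing R] [Algebra A R] [CommRing S] [Algebra A S] [Algebra B S] [IsScalarTower A B S]
    (φ : R →ₐ[A] S) : B ⊗[A] R →ₐ[B] S :=
  Algebra.TensorProduct.lift (Algebra.ofId B S) φ (fun _ _ => Commute.all _ _)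

end ResidualPerfection

/-! The point is that `B ⊗[A] -` takes `CRP_A` to `CRP_B` and preserves both constructions. Since
`B` is finite free over `A`, flatness and completeness pass to `B ⊗[A] R`. Perfectness passes
because the `p`-th powers of an `A`-basis of `B` are again an `A`-basis (`exists_basis_pow`): this
is separability of the residue extension, lifted by Nakayama. Conversely `𝔭_A B = 𝔭_B`, so objects
of `CRP_B` lie in `CRP_A`, and extension of scalars makes `B ⊗[A] Aᵘ` initial in `CRP_B`.

For `Aᵍ`, a determinant argument (`IsFractionHom.of_basis`) shows that total fraction rings survive
finite free base change; no reduction has to be a domain. It remains to see that an object of `CRP`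
whose reduction is the fraction ring of `Ū` is unique. Maps out of it exist by
`exists_algHom_of_isFractionHom`: a localization of `U` agrees with it modulo each power of the
uniformizer. They are unique by `algHom_ext_of_reduction`, since taking `p`-th powers sharpens
congruences. -/

namespace ResidualPerfection

open nonZeroDivisors

/-! ### Fraction rings and Frobenius under finite free base change -/

/-- A ring homomorphism that exhibits its target as the total ring of fractions of its source. -/
structure IsFractionHom {R S : Type*} [CommRing R] [CommRing S] (f : R →+* S) : Prop where
  isUnit_map : ∀ r ∈ R⁰, IsUnit (f r)
  exists_mul_eq : ∀ s : S, ∃ x, ∃ r ∈ R⁰, s * f r = f x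
  injective : Function.Injective f

theorem isFractionHom_of_isFractionRing {R S : Type*} [CommRing R] [CommRing S] (f : R →+* S)
    (h : letI : Algebra R S := f.toAlgebra; IsFractionRing R S) : IsFractionHom f := by
  let : Algebra R S := f.toAlgebra
  have : IsFractionRing R S := h
  refine ⟨fun r hr => IsLocalization.map_units S (⟨r, hr⟩ : R⁰), fun s => ?_,
    IsFractionRing.injective R S⟩
  obtain ⟨⟨x, r⟩, hx⟩ := IsLocalization.surj R⁰ s
  exact ⟨x, r, r.2, hx⟩

/-- Fraction homomorphisms are invariant under isomorphisms of source and target. -/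
theorem IsFractionHom.of_ringEquiv {R S R' S' : Type*} [CommRing R] [CommRing S] [CommRing R']
    [CommRing S'] {f : R →+* S} {f' : R' →+* S'} (hf : IsFractionHom f) (e : R' ≃+* R)
    (e' : S' ≃+* S) (h : ∀ x, e' (f' x) = f (e x)) : IsFractionHom f' := by
  have hmem : ∀ r : R', r ∈ R'⁰ ↔ e r ∈ R⁰ := fun r =>
    by
    rw [← MulEquivClass.map_nonZeroDivisors e]
    exact ⟨fun h => ⟨r, h, rfl⟩, fun ⟨x, hx, h⟩ => e.injective h ▸ hx⟩
  refine ⟨fun r hr => ?_, fun s => ?_, fun x y hxy => ?_⟩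
  · rw [← MulEquiv.isUnit_map e', h]
    exact hf.isUnit_map _ ((hmem r).1 hr)
  · obtain ⟨x, r, hr, hx⟩ := hf.exists_mul_eq (e' s)
    refine ⟨e.symm x, e.symm r, by simpa [hmem] using hr, e'.injective ?_⟩
    simp [h, hx]
  · exact e.injective (hf.injective (by rw [← h, ← h, hxy]))

/-- McCoy: in a finite free algebra, multiplication by a nonzerodivisor has regular determinant. -/
theorem det_leftMulMatrix_mem_nonZeroDivisors {R T ι : Type*} [CommRing R] [CommRing T]
    [Algebra R T] [Fintype ι] [DecidableEq ι] (c : Module.Basis ι R T) {t : T} (ht : t ∈ T⁰) :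
    (Algebra.leftMulMatrix c t).det ∈ R⁰ := by
  rw [← Matrix.nonsingular_iff_det_mem_nonZeroDivisors, ← Matrix.linearIndependent_col_iff,
    ← Matrix.mulVec_injective_iff]
  intro v w hvw
  apply c.equivFun.symm.injective
  refine (mul_cancel_left_mem_nonZeroDivisors ht).1 (c.equivFun.injective ?_)
  have key : ∀ v : ι → R, c.equivFun (t * c.equivFun.symm v) =
      (Algebra.leftMulMatrix c t).mulVec v := fun v => by
    have := Algebra.leftMulMatrix_mulVec_repr c t (c.equivFun.symm v)
    rw [Module.Basis.equivFun_apply, ← this, ← Module.Basis.equivFun_apply,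
      LinearEquiv.apply_symm_apply]
  rw [key, key]
  exact hvw

/-- The finite free base change of a fraction homomorphism is a fraction homomorphism. -/
theorem IsFractionHom.of_basis {R R' T T' ι : Type*} [CommRing R] [CommRing R'] [CommRing T]
    [CommRing T'] [Algebra R T] [Algebra R' T'] [Finite ι] {f : R →+* R'}
    (hf : IsFractionHom f) (c : Module.Basis ι R T) (c' : Module.Basis ι R' T') (F : T →+* T')
    (hF : ∀ r, F (algebraMap R T r) = algebraMap R' T' (f r)) (hc : ∀ i, F (c i) = c' i) :
    IsFractionHom F := by
  classical
  cases nonempty_fintype ι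
  have hsmul : ∀ r t, F (r • t) = f r • F t := fun r t => by
    rw [Algebra.smul_def, map_mul, hF, Algebra.smul_def]
  have hrepr : ∀ t i, c'.repr (F t) i = f (c.repr t i) := by
    intro t i
    conv_lhs => rw [← c.sum_repr t, map_sum]
    simp_rw [hsmul, hc]
    rw [c'.repr_sum_self]
  refine ⟨fun t ht => ?_, fun s => ?_, fun x y hxy => ?_⟩
  -- The matrix of `F t` is the image of that of `t`, whose determinant is regular; so it becomes
  -- invertible, and `1` is a multiple of `F t`.
  · have hmat : Algebra.leftMulMatrix c' (F t) = (Algebra.leftMulMatrix c t).map f := by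
      ext i j
      rw [Algebra.leftMulMatrix_eq_repr_mul, Matrix.map_apply, Algebra.leftMulMatrix_eq_repr_mul,
        ← hrepr, F.map_mul, hc]
    have hdet : IsUnit (Algebra.leftMulMatrix c' (F t)).det := by
      rw [hmat, ← RingHom.mapMatrix_apply, ← RingHom.map_det]
      exact hf.isUnit_map _ (det_leftMulMatrix_mem_nonZeroDivisors c ht)
    have hsurj := Matrix.mulVec_surjective_iff_isUnit.2 ((Matrix.isUnit_iff_isUnit_det _).2 hdet)
    obtain ⟨v, hv⟩ := hsurj (c'.repr 1)
    refine IsUnit.of_mul_eq_one (c'.equivFun.symm v) (c'.equivFun.injective ?_)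
    have := Algebra.leftMulMatrix_mulVec_repr c' (F t) (c'.equivFun.symm v)
    rw [Module.Basis.equivFun_apply, ← this, ← Module.Basis.equivFun_apply,
      LinearEquiv.apply_symm_apply, hv, Module.Basis.equivFun_apply]
  · choose x r hr hx using fun i => hf.exists_mul_eq (c'.repr s i)
    -- The common denominator is the product of the `r i`; each numerator absorbs the other
    -- denominators.
    refine ⟨∑ i, (x i * ∏ j ∈ Finset.univ.erase i, r j) • c i, algebraMap R T (∏ i, r i), ?_, ?_⟩
    · have hprod : ∏ i, r i ∈ R⁰ := prod_mem fun i _ => hr i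
      refine mem_nonZeroDivisors_iff_right.2 fun y hy => c.ext_elem fun i => ?_
      have := congrArg (fun z => c.repr z i) hy
      simp only [mul_comm y, ← Algebra.smul_def, map_smul, map_zero, Finsupp.smul_apply,
        Finsupp.zero_apply, smul_eq_mul] at this
      simpa using (mul_left_mem_nonZeroDivisors_eq_zero_iff hprod).1 this
    · rw [hF, mul_comm, ← Algebra.smul_def, map_sum]
      conv_lhs => rw [← c'.sum_repr s, Finset.smul_sum]
      refine Finset.sum_congr rfl fun i _ => ?_
      rw [hsmul, hc, smul_smul, map_mul, ← hx, ← Finset.mul_prod_erase _ _ (Finset.mem_univ i),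
        map_mul]
      congr 1
      ring
  · exact c.ext_elem fun i => hf.injective (by rw [← hrepr, ← hrepr, hxy])

/-- A finite free algebra over a perfect ring is perfect if some basis is mapped to a basis
by the Frobenius. -/
theorem perfectRing_of_basis_pow (p : ℕ) [Fact p.Prime] {R T ι : Type*} [CommRing R] [CommRing T]
    [Algebra R T] [Finite ι] (hp : (p : T) = 0) [PerfectRing R p] (c c' : Module.Basis ι R T)
    (hc : ∀ i, c i ^ p = c' i) : PerfectRing T p := by
  classical
  cases nonempty_fintype ι
  rcases subsingleton_or_nontrivial T with hT | hT
  -- The zero ring does not have characteristic `p`, so it is treated apart.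
  · exact ⟨fun _ _ _ => Subsingleton.elim _ _, fun y => ⟨y, Subsingleton.elim _ _⟩⟩
  have : CharP T p := ringChar.of_eq (CharP.ringChar_of_prime_eq_zero Fact.out hp)
  have hbij : Function.Bijective fun x : R => x ^ p := PerfectRing.bijective_frobenius
  have hsum : ∀ v : ι → R, (∑ i, v i • c i) ^ p = ∑ i, v i ^ p • c' i := fun v => by
    rw [sum_pow_char]
    simp only [Algebra.smul_def, mul_pow, hc, map_pow]
  refine ⟨fun x y hxy => ?_, fun y => ?_⟩
  · refine c.ext_elem fun i => hbij.1 ?_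
    have := congrArg (fun z => c'.repr z i) hxy
    simp only at this
    rwa [← c.sum_repr x, ← c.sum_repr y, hsum, hsum, c'.repr_sum_self, c'.repr_sum_self] at this
  · choose v hv using fun i => hbij.2 (c'.repr y i)
    refine ⟨∑ i, v i • c i, ?_⟩
    simp only at hv ⊢
    rw [hsum]
    simp only [hv]
    exact c'.sum_repr y

/-! ### Extending maps by successive approximation -/

open IsLocalRing

theorem mem_nonZeroDivisors_of_flat {A R : Type*} [CommRing A] [IsDomain A] [CommRing R] [Algebra A R]
    [Module.Flat A R] {ϖ : A} (h : ϖ ≠ 0) : algebraMap A R ϖ ∈ R⁰ := by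
  refine mem_nonZeroDivisors_iff_right.2 fun x hx => ?_
  rw [mul_comm, ← Algebra.smul_def] at hx
  exact (smul_eq_zero_iff_right h).1 hx

section PrincipalMaximalIdeal

variable {A : Type*} [CommRing A] [IsLocalRing A] {ϖ : A}

theorem mem_residualIdeal_pow_iff {R : Type*} [CommRing R] [Algebra A R]
    (hϖ : maximalIdeal A = Ideal.span {ϖ}) (n : ℕ) (x : R) :
    x ∈ residualIdeal A R ^ n ↔ ∃ y, x = algebraMap A R ϖ ^ n * y := by
  rw [residualIdeal, hϖ, Ideal.map_span, Set.image_singleton, Ideal.span_singleton_pow,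
    Ideal.mem_span_singleton]
  rfl

theorem mem_residualIdeal_iff {R : Type*} [CommRing R] [Algebra A R]
    (hϖ : maximalIdeal A = Ideal.span {ϖ}) (x : R) :
    x ∈ residualIdeal A R ↔ ∃ y, x = algebraMap A R ϖ * y := by
  simpa using mem_residualIdeal_pow_iff (R := R) hϖ 1 x

theorem map_mem_residualIdeal_pow {R S : Type*} [CommRing R] [Algebra A R] [CommRing S]
    [Algebra A S] (f : R →ₐ[A] S) {n : ℕ} {x : R} (hx : x ∈ residualIdeal A R ^ n) :
    f x ∈ residualIdeal A S ^ n := by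
  have h := Ideal.mem_map_of_mem f.toRingHom hx
  rw [Ideal.map_pow] at h
  exact Ideal.pow_right_mono (Ideal.map_le_iff_le_comap.2 (residualIdeal_le_comap f)) n h

variable {L G S : Type*} [CommRing L] [Algebra A L] [CommRing G] [Algebra A G]
  [CommRing S] [Algebra A S]

/-- The error at stage `n` is `ϖ ^ n * y`; approximating `y` modulo `ϖ` gains one power. -/
theorem exists_sub_mem_residualIdeal_pow (hϖ : maximalIdeal A = Ideal.span {ϖ}) (h : L →ₐ[A] G)
    (hsurj : ∀ x : G, ∃ l, x - h l ∈ residualIdeal A G) (n : ℕ) (x : G) :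
    ∃ l, x - h l ∈ residualIdeal A G ^ n := by
  induction n with
  | zero => exact ⟨0, by simp⟩
  | succ n ih =>
    obtain ⟨l, hl⟩ := ih
    obtain ⟨y, hy⟩ := (mem_residualIdeal_pow_iff hϖ n _).1 hl
    obtain ⟨l', hl'⟩ := hsurj y
    obtain ⟨z, hz⟩ := (mem_residualIdeal_iff hϖ _).1 hl'
    refine ⟨l + algebraMap A L ϖ ^ n * l', (mem_residualIdeal_pow_iff hϖ _ _).2 ⟨z, ?_⟩⟩
    rw [map_add, map_mul, map_pow, h.commutes]
    linear_combination hy + algebraMap A G ϖ ^ n * hz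

/-- Divide by `ϖ` and induct; only `G` needs `ϖ` to be regular, so `L` need not be flat. -/
theorem mem_residualIdeal_pow_of_map_mem (hϖ : maximalIdeal A = Ideal.span {ϖ}) (h : L →ₐ[A] G)
    (hreg : algebraMap A G ϖ ∈ G⁰)
    (hinj : ∀ l, h l ∈ residualIdeal A G → l ∈ residualIdeal A L) (n : ℕ) (l : L)
    (hl : h l ∈ residualIdeal A G ^ n) : l ∈ residualIdeal A L ^ n := by
  induction n generalizing l with
  | zero => simp
  | succ n ih =>
    obtain ⟨x, hx⟩ := (mem_residualIdeal_pow_iff hϖ _ _).1 hl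
    obtain ⟨y, rfl⟩ := (mem_residualIdeal_iff hϖ _).1 (hinj l
      (Ideal.pow_le_self n.succ_ne_zero hl))
    have hy : h y = algebraMap A G ϖ ^ n * x := by
      rw [map_mul, h.commutes, pow_succ', mul_assoc] at hx
      exact (mul_cancel_left_mem_nonZeroDivisors hreg).1 hx
    obtain ⟨z, rfl⟩ := (mem_residualIdeal_pow_iff hϖ _ _).1
      (ih y ((mem_residualIdeal_pow_iff hϖ _ _).2 ⟨x, hy⟩))
    exact (mem_residualIdeal_pow_iff hϖ _ _).2 ⟨z, by ring⟩

theorem exists_algHom_quotient_residualIdeal_pow (hϖ : maximalIdeal A = Ideal.span {ϖ})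
    (h : L →ₐ[A] G) (hreg : algebraMap A G ϖ ∈ G⁰)
    (hsurj : ∀ x : G, ∃ l, x - h l ∈ residualIdeal A G)
    (hinj : ∀ l, h l ∈ residualIdeal A G → l ∈ residualIdeal A L) (g : L →ₐ[A] S) (n : ℕ) :
    ∃ φ : G →ₐ[A] S ⧸ residualIdeal A S ^ n,
      ∀ x l, x - h l ∈ residualIdeal A G ^ n → φ x = Ideal.Quotient.mk _ (g l) := by
  -- `G` modulo the `n`-th power is `L` modulo the kernel of `ψ`, and `g` sends that kernel into the
  -- `n`-th power in `S`.
  let ψ : L →ₐ[A] G ⧸ residualIdeal A G ^ n := (Ideal.Quotient.mkₐ A _).comp h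
  have hψ : Function.Surjective ψ := fun x => by
    obtain ⟨x, rfl⟩ := Ideal.Quotient.mk_surjective x
    obtain ⟨l, hl⟩ := exists_sub_mem_residualIdeal_pow hϖ h hsurj n x
    exact ⟨l, (Ideal.Quotient.eq.2 hl).symm⟩
  have hker : ∀ l ∈ RingHom.ker ψ, ((Ideal.Quotient.mkₐ A (residualIdeal A S ^ n)).comp g) l = 0 :=
    fun l hl => Ideal.Quotient.eq_zero_iff_mem.2 <| map_mem_residualIdeal_pow g <|
      mem_residualIdeal_pow_of_map_mem hϖ h hreg hinj n l (Ideal.Quotient.eq_zero_iff_mem.1 hl)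
  refine ⟨(Ideal.Quotient.liftₐ _ _ hker).comp
    ((Ideal.quotientKerAlgEquivOfSurjective hψ).symm.toAlgHom.comp (Ideal.Quotient.mkₐ A _)),
    fun x l hx => ?_⟩
  have hx' : Ideal.Quotient.mk (residualIdeal A G ^ n) x = ψ l := Ideal.Quotient.eq.2 hx
  have : (Ideal.quotientKerAlgEquivOfSurjective hψ).symm (ψ l) = Ideal.Quotient.mk _ l := by
    rw [AlgEquiv.symm_apply_eq, Ideal.quotientKerAlgEquivOfSurjective_mk]
  simp only [AlgHom.comp_apply, Ideal.Quotient.mkₐ_eq_mk, AlgEquiv.toAlgHom_apply, hx', this]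
  rfl

/-- A map to a complete algebra extends along a map that is an isomorphism modulo the
uniformizer. -/
theorem exists_algHom_extension (hϖ : maximalIdeal A = Ideal.span {ϖ})
    (h : L →ₐ[A] G) (hreg : algebraMap A G ϖ ∈ G⁰)
    (hsurj : ∀ x : G, ∃ l, x - h l ∈ residualIdeal A G)
    (hinj : ∀ l, h l ∈ residualIdeal A G → l ∈ residualIdeal A L)
    (hS : IsAdicComplete (residualIdeal A S) S) (g : L →ₐ[A] S) :
    ∃ k : G →ₐ[A] S, k.comp h = g := by
  choose φ hφ using exists_algHom_quotient_residualIdeal_pow hϖ h hreg hsurj hinj g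
  refine ⟨IsAdicComplete.liftAlgHom (residualIdeal A S) φ fun {m n} hle => ?_, ?_⟩
  · ext x
    obtain ⟨l, hl⟩ := exists_sub_mem_residualIdeal_pow hϖ h hsurj n x
    rw [AlgHom.comp_apply, hφ n x l hl, hφ m x l (Ideal.pow_le_pow_right hle hl)]
    rfl
  · refine IsAdicComplete.algHom_ext (residualIdeal A S) fun n => ?_
    rw [← AlgHom.comp_assoc, IsAdicComplete.mkₐ_comp_liftAlgHom]
    ext l
    rw [AlgHom.comp_apply, hφ n _ l (by simp)]
    rfl

end PrincipalMaximalIdeal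

/-! ### Uniqueness of lifts from the reduction -/

section Uniqueness

/-- The cofactor of `a - b` in `a ^ p - b ^ p` is congruent to `p * a ^ (p - 1)` modulo `I`, hence
lies in `I`. -/
theorem pow_sub_pow_mem_pow_succ {R : Type*} [CommRing R] {I : Ideal R} {p : ℕ} (hp : (p : R) ∈ I)
    {n : ℕ} {a b : R} (h : a - b ∈ I ^ (n + 1)) : a ^ p - b ^ p ∈ I ^ (n + 2) := by
  rw [← (Commute.all a b).geom_sum₂_mul p, pow_succ']
  refine Ideal.mul_mem_mul ?_ h
  have hab : Ideal.Quotient.mk I a = Ideal.Quotient.mk I b :=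
    Ideal.Quotient.eq.2 (Ideal.pow_le_self n.succ_ne_zero h)
  rw [← Ideal.Quotient.eq_zero_iff_mem] at hp ⊢
  rw [map_natCast] at hp
  rw [RingHom.map_geom_sum₂, hab, geom_sum₂_self, hp, zero_mul]

/-- Homomorphisms in `CRP_A` are determined by their reductions. -/
theorem algHom_ext_of_reduction {A : Type*} [CommRing A] [IsLocalRing A] {p : ℕ}
    [CharP (ResidueField A) p] {R S : Type*} [CommRing R] [Algebra A R] [CommRing S] [Algebra A S]
    {ϖ : A} (hϖ : maximalIdeal A = Ideal.span {ϖ})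
    (hR : PerfectRing (Reduction A R) p) (hS : IsAdicComplete (residualIdeal A S) S)
    {f g : R →ₐ[A] S} (h : ∀ x, f x - g x ∈ residualIdeal A S) : f = g := by
  have hp : (p : S) ∈ residualIdeal A S := by
    have : (p : A) ∈ maximalIdeal A := by
      rw [← IsLocalRing.residue_eq_zero_iff, map_natCast, CharP.cast_eq_zero]
    simpa using Ideal.mem_map_of_mem (algebraMap A S) this
  have key : ∀ n x, f x - g x ∈ residualIdeal A S ^ (n + 1) := by
    intro n
    induction n with
    | zero => simpa using h
    | succ n ih =>
      -- Perfectness gives `x = y ^ p + ϖ * z`; both the `p`-th power and the factor `ϖ` gain one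
      -- order.
      intro x
      obtain ⟨y, hy⟩ := hR.bijective_frobenius.2 (Ideal.Quotient.mk _ x)
      obtain ⟨y, rfl⟩ := Ideal.Quotient.mk_surjective y
      obtain ⟨z, hz⟩ := (mem_residualIdeal_iff hϖ _).1 (Ideal.Quotient.eq.1 hy.symm)
      have hx : f x - g x = (f y ^ p - g y ^ p) + algebraMap A S ϖ * (f z - g z) := by
        rw [eq_add_of_sub_eq hz]
        simp only [map_add, map_mul, map_pow, AlgHom.commutes]
        ring
      rw [hx]
      refine add_mem (pow_sub_pow_mem_pow_succ hp (ih y)) ?_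
      rw [pow_succ']
      refine Ideal.mul_mem_mul (Ideal.mem_map_of_mem _ ?_) (ih z)
      exact hϖ ▸ Ideal.mem_span_singleton_self ϖ
  refine IsAdicComplete.algHom_ext (residualIdeal A S) fun n => AlgHom.ext fun x =>
    Ideal.Quotient.eq.2 (Ideal.pow_le_pow_right n.le_succ (key n x))

end Uniqueness

/-! ### Universal property of the generic residual perfection -/

section Generic

variable {p : ℕ} {A : Type u} [CommRing A] [IsLocalRing A] {U G S : Type u}
  [CommRing U] [Algebra A U] [CommRing G] [Algebra A G] [CommRing S] [Algebra A S]

@[simp]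
theorem reductionMap_mk (f : U →ₐ[A] G) (x : U) :
    reductionMap f (Ideal.Quotient.mk _ x) = Ideal.Quotient.mk _ (f x) :=
  rfl

theorem isUnit_of_isUnit_reduction (hS : IsAdicComplete (residualIdeal A S) S) {s : S}
    (h : IsUnit (Ideal.Quotient.mk (residualIdeal A S) s)) : IsUnit s := by
  have : IsLocalHom (Ideal.Quotient.mk (residualIdeal A S)) :=
    (isLocalHom_of_le_jacobson_bot _ (IsAdicComplete.le_jacobson_bot _))
  exact isUnit_of_map_unit (Ideal.Quotient.mk (residualIdeal A S)) s h

/-- The mapping property of a flat complete algebra whose reduction is the total fraction ring of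
the reduction of `U`. -/
theorem exists_algHom_of_isFractionHom [IsDomain A] {ϖ : A} (h0 : ϖ ≠ 0)
    (hϖ : maximalIdeal A = Ideal.span {ϖ})
    (hG : IsCompleteResidualPerfection p A G) (f : U →ₐ[A] G)
    (hf : IsFractionHom (reductionMap f)) (hS : IsAdicComplete (residualIdeal A S) S)
    (g : U →ₐ[A] S) (hg : ∀ x ∈ (Reduction A U)⁰, IsUnit (reductionMap g x)) :
    ∃ k : G →ₐ[A] S, k.comp f = g := by
  -- Elements of `M` become units in `G` and in `S` by completeness, so both maps extend to
  -- `Localization M`, which maps isomorphically to `G` modulo `ϖ`.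
  let M : Submonoid U := (Reduction A U)⁰.comap (Ideal.Quotient.mk (residualIdeal A U))
  have hM : ∀ {x}, x ∈ M ↔ Ideal.Quotient.mk (residualIdeal A U) x ∈ (Reduction A U)⁰ := Iff.rfl
  have hfM : ∀ m : M, IsUnit (f m) := fun m =>
    isUnit_of_isUnit_reduction hG.complete (hf.isUnit_map _ m.2)
  have hgM : ∀ m : M, IsUnit (g m) := fun m => isUnit_of_isUnit_reduction hS (hg _ m.2)
  let h : Localization M →ₐ[A] G := IsLocalization.liftAlgHom (M := M) (f := f) hfM
  let g' : Localization M →ₐ[A] S := IsLocalization.liftAlgHom (M := M) (f := g) hgM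
  have hh : ∀ x, h (algebraMap U _ x) = f x := fun x => IsLocalization.lift_eq _ x
  have hg' : ∀ x, g' (algebraMap U _ x) = g x := fun x => IsLocalization.lift_eq _ x
  have hflat := hG.flat
  have hmk : ∀ (x : U) (m : M), f m * h (IsLocalization.mk' _ x m) = f x := fun x m => by
    rw [← hh, ← map_mul, IsLocalization.mk'_spec', hh]
  obtain ⟨k, hk⟩ := exists_algHom_extension hϖ h (mem_nonZeroDivisors_of_flat h0) (fun y => by
      obtain ⟨x, m, hm, hy⟩ := hf.exists_mul_eq (Ideal.Quotient.mk _ y)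
      obtain ⟨x, rfl⟩ := Ideal.Quotient.mk_surjective x
      obtain ⟨m, rfl⟩ := Ideal.Quotient.mk_surjective m
      refine ⟨IsLocalization.mk' _ x (⟨m, hm⟩ : M), ?_⟩
      rw [← Ideal.unit_mul_mem_iff_mem _ (hfM ⟨m, hm⟩), mul_sub, hmk, mul_comm]
      exact Ideal.Quotient.eq.1 hy) (fun l hl => by
      obtain ⟨x, m, rfl⟩ := IsLocalization.exists_mk'_eq M l
      rw [← Ideal.unit_mul_mem_iff_mem _ (hfM m), hmk] at hl
      have hx : x ∈ residualIdeal A U := by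
        rw [← Ideal.Quotient.eq_zero_iff_mem] at hl ⊢
        exact hf.injective (by rw [map_zero]; exact hl)
      rw [← Ideal.unit_mul_mem_iff_mem _ (IsLocalization.map_units (Localization M) m),
        IsLocalization.mk'_spec']
      exact residualIdeal_le_comap (IsScalarTower.toAlgHom A U (Localization M)) hx) hS g'
  refine ⟨k, AlgHom.ext fun x => ?_⟩
  rw [AlgHom.comp_apply, ← hh, ← hg', ← hk, AlgHom.comp_apply]

variable [CharP (ResidueField A) p]

/-- A homomorphism out of a generic residual perfection is determined by its restriction to the
universal one. -/
theorem algHom_ext_of_isFractionHom {ϖ : A} (hϖ : maximalIdeal A = Ideal.span {ϖ})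
    (hG : IsCompleteResidualPerfection p A G) (f : U →ₐ[A] G)
    (hf : IsFractionHom (reductionMap f)) (hS : IsAdicComplete (residualIdeal A S) S)
    {k k' : G →ₐ[A] S} (h : k.comp f = k'.comp f) : k = k' := by
  refine algHom_ext_of_reduction hϖ hG.perfect hS fun y => Ideal.Quotient.eq.1 ?_
  obtain ⟨x, m, hm, hy⟩ := hf.exists_mul_eq (Ideal.Quotient.mk _ y)
  have hr : ∀ z, reductionMap k (reductionMap f z) = reductionMap k' (reductionMap f z) := by
    intro z
    obtain ⟨z, rfl⟩ := Ideal.Quotient.mk_surjective z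
    simp only [reductionMap_mk, ← AlgHom.comp_apply, h]
  have hu := (hf.isUnit_map _ hm).map (reductionMap k)
  rw [← reductionMap_mk, ← reductionMap_mk]
  refine hu.mul_right_cancel ?_
  rw [← map_mul, hy, hr, hr, ← map_mul, hy]

/-- `G` and `S` satisfy the same mapping property under `U`. -/
theorem exists_algEquiv_of_isFractionHom [IsDomain A] {ϖ : A} (h0 : ϖ ≠ 0)
    (hϖ : maximalIdeal A = Ideal.span {ϖ})
    (hG : IsCompleteResidualPerfection p A G) (f : U →ₐ[A] G) (hf : IsFractionHom (reductionMap f))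
    (hS : IsCompleteResidualPerfection p A S) (g : U →ₐ[A] S)
    (hg : IsFractionHom (reductionMap g)) : Nonempty (G ≃ₐ[A] S) := by
  obtain ⟨k, hk⟩ := exists_algHom_of_isFractionHom h0 hϖ hG f hf hS.complete g hg.isUnit_map
  obtain ⟨l, hl⟩ := exists_algHom_of_isFractionHom h0 hϖ hS g hg hG.complete f hf.isUnit_map
  refine ⟨AlgEquiv.ofAlgHom k l ?_ ?_⟩
  · exact algHom_ext_of_isFractionHom hϖ hS g hg hS.complete
      (by rw [AlgHom.comp_assoc, hl, hk, AlgHom.id_comp])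
  · exact algHom_ext_of_isFractionHom hϖ hG f hf hG.complete
      (by rw [AlgHom.comp_assoc, hk, hl, AlgHom.id_comp])

end Generic


/-! ### Completeness of finite free modules -/

section AdicComplete

theorem mem_span_singleton_pow_smul_top_iff {A M : Type*} [CommRing A] [AddCommGroup M]
    [Module A M] (a : A) (n : ℕ) (x : M) :
    x ∈ (Ideal.span {a} ^ n • ⊤ : Submodule A M) ↔ ∃ y, a ^ n • y = x := by
  rw [Ideal.span_singleton_pow, Submodule.ideal_span_singleton_smul,
    Submodule.mem_smul_pointwise_iff_exists]
  simp

/-- With a principal ideal, completeness is a statement about multiples of `a ^ n` and can be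
checked coordinatewise. -/
theorem isAdicComplete_span_singleton_iff {A M : Type*} [CommRing A] [AddCommGroup M]
    [Module A M] (a : A) : IsAdicComplete (Ideal.span {a}) M ↔
      (∀ x : M, (∀ n : ℕ, ∃ y, a ^ n • y = x) → x = 0) ∧
      ∀ f : ℕ → M, (∀ {m n}, m ≤ n → ∃ y, a ^ m • y = f m - f n) →
        ∃ l, ∀ n, ∃ y, a ^ n • y = f n - l := by
  simp only [isAdicComplete_iff, isHausdorff_iff, isPrecomplete_iff, SModEq.sub_mem, sub_zero,
    mem_span_singleton_pow_smul_top_iff]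

theorem isAdicComplete_pi {A M ι : Type*} [CommRing A] [AddCommGroup M] [Module A M] (a : A)
    (h : IsAdicComplete (Ideal.span {a}) M) : IsAdicComplete (Ideal.span {a}) (ι → M) := by
  rw [isAdicComplete_span_singleton_iff] at h ⊢
  refine ⟨fun x hx => funext fun i => h.1 _ fun n => ?_, fun f hf => ?_⟩
  · obtain ⟨y, rfl⟩ := hx n
    exact ⟨y i, rfl⟩
  · choose l hl using fun i => h.2 (fun n => f n i) fun {m n} hmn => by
      obtain ⟨y, hy⟩ := hf hmn
      exact ⟨y i, congrFun hy i⟩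
    choose y hy using hl
    exact ⟨l, fun n => ⟨fun i => y i n, funext fun i => hy i n⟩⟩

theorem isAdicComplete_of_linearEquiv {A M N : Type*} [CommRing A] [AddCommGroup M] [Module A M]
    [AddCommGroup N] [Module A N] (e : M ≃ₗ[A] N) (a : A)
    (h : IsAdicComplete (Ideal.span {a}) M) : IsAdicComplete (Ideal.span {a}) N := by
  rw [isAdicComplete_span_singleton_iff] at h ⊢
  refine ⟨fun x hx => e.symm.injective ?_, fun f hf => ?_⟩
  · rw [map_zero]
    refine h.1 _ fun n => ?_
    obtain ⟨y, rfl⟩ := hx n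
    exact ⟨e.symm y, by simp⟩
  · obtain ⟨l, hl⟩ := h.2 (fun n => e.symm (f n)) fun {m n} hmn => by
      obtain ⟨y, hy⟩ := hf hmn
      exact ⟨e.symm y, by rw [← map_smul, hy, map_sub]⟩
    refine ⟨e l, fun n => ?_⟩
    obtain ⟨y, hy⟩ := hl n
    exact ⟨e y, by rw [← map_smul, hy, map_sub, LinearEquiv.apply_symm_apply]⟩

end AdicComplete

theorem residue_smul {A B : Type*} [CommRing A] [IsLocalRing A] [CommRing B] [IsLocalRing B]
    [Algebra A B] [IsLocalHom (algebraMap A B)] (a : A) (x : B) :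
    residue B (a • x) = residue A a • residue B x := by
  rw [Algebra.smul_def, map_mul, Algebra.smul_def]
  rfl

/-! ### Base change along a finite étale extension -/

section FiniteEtale

variable (p : ℕ) {A B : Type*} [CommRing A] [IsLocalRing A] [CommRing B] [IsLocalRing B]
  [Algebra A B] [IsLocalHom (algebraMap A B)] [Algebra.Etale A B]

theorem residualIdeal_eq_of_etale (A B : Type*) [CommRing A] [IsLocalRing A] [CommRing B]
    [IsLocalRing B] [Algebra A B] [IsLocalHom (algebraMap A B)] [Algebra.Etale A B]
    (S : Type*) [CommRing S] [Algebra A S] [Algebra B S]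
    [IsScalarTower A B S] : residualIdeal B S = residualIdeal A S := by
  rw [residualIdeal, residualIdeal, IsScalarTower.algebraMap_eq A B S, ← Ideal.map_map,
    Algebra.FormallyUnramified.map_maximalIdeal (R := A) (S := B)]

theorem perfectRing_of_ringEquiv {R S : Type*} [CommRing R] [CommRing S] (e : R ≃+* S)
    [PerfectRing R p] : PerfectRing S p := by
  have h : Function.Bijective fun x : R => x ^ p := PerfectRing.bijective_frobenius
  refine ⟨?_⟩
  have : (fun x : S => x ^ p) = e ∘ (fun x : R => x ^ p) ∘ e.symm := by ext; simp
  rw [this]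
  exact e.bijective.comp (h.comp e.symm.bijective)

/-- An object of `CRP_B` is an object of `CRP_A`. -/
theorem IsCompleteResidualPerfection.restrictScalars {S : Type*} [CommRing S] [Algebra A S]
    [Algebra B S] [IsScalarTower A B S] (h : IsCompleteResidualPerfection p B S) :
    IsCompleteResidualPerfection p A S := by
  have hI := residualIdeal_eq_of_etale A B S
  have := h.flat
  have := h.perfect
  exact ⟨Module.Flat.trans A B S, hI ▸ h.complete,
    perfectRing_of_ringEquiv p (Ideal.quotEquivOfEq hI)⟩

/-- The reduction of a base change is the base change of the reduction. -/
noncomputable def reductionBaseChange (A B R : Type*) [CommRing A] [IsLocalRing A] [CommRing B]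
    [IsLocalRing B] [Algebra A B] [IsLocalHom (algebraMap A B)]
    [Algebra.Etale A B] [CommRing R] [Algebra A R] :
    Reduction A R ⊗[A] B ≃+* Reduction B (B ⊗[A] R) :=
  (Algebra.TensorProduct.comm A (Reduction A R) B).toRingEquiv.trans <|
    (Algebra.TensorProduct.tensorQuotientEquiv (R := A) B R B (residualIdeal A R)).toRingEquiv.trans
      (Ideal.quotEquivOfEq <| by
        rw [residualIdeal_eq_of_etale A B, residualIdeal, residualIdeal]
        refine (Ideal.map_map (algebraMap A R)
          (Algebra.TensorProduct.includeRight (R := A) (A := B) (B := R)).toRingHom).trans ?_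
        exact congrArg (fun f => Ideal.map f (maximalIdeal A))
          (Algebra.TensorProduct.includeRight (R := A) (A := B) (B := R)).comp_algebraMap)

variable [Module.Finite A B] [CharP (ResidueField A) p] [Fact p.Prime]

/-- The `p`-th powers of a basis of a finite étale extension form a basis. -/
theorem exists_basis_pow {ι : Type*} [Finite ι] (b : Module.Basis ι A B) :
    ∃ b' : Module.Basis ι A B, ∀ i, b' i = b i ^ p := by
  cases nonempty_fintype ι
  have hspan : ⊤ ≤ Submodule.span A (Set.range fun i => b i ^ p) := by
    refine Submodule.le_of_le_smul_of_le_jacobson_bot (I := maximalIdeal A) Module.Finite.fg_top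
      (maximalIdeal_le_jacobson _) fun x _ => ?_
    have h1 : Submodule.span (ResidueField A) (Set.range fun i => residue B (b i)) = ⊤ := by
      refine eq_top_iff.2 fun y _ => ?_
      obtain ⟨y, rfl⟩ := residue_surjective y
      rw [← b.sum_repr y, map_sum]
      refine sum_mem fun i _ => ?_
      rw [residue_smul]
      exact Submodule.smul_mem _ _ (Submodule.subset_span ⟨i, rfl⟩)
    have : ExpChar (ResidueField A) p := ExpChar.prime Fact.out
    -- Over a separable extension, `p`-th powers of a spanning family still span; Nakayama
    -- transports this to `B`.
    have h2 := Field.span_map_pow_expChar_pow_eq_top_of_isSeparable p 1 h1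
    obtain ⟨c, hc⟩ := (Submodule.mem_span_range_iff_exists_fun _).1
      (h2.ge (Submodule.mem_top (x := residue B x)))
    choose a ha using fun i => residue_surjective (c i)
    rw [← sub_add_cancel x (∑ i, a i • b i ^ p), add_comm]
    refine Submodule.add_mem_sup (sum_mem fun i _ =>
      Submodule.smul_mem _ _ (Submodule.subset_span ⟨i, rfl⟩)) ?_
    rw [Ideal.smul_top_eq_map, Submodule.restrictScalars_mem,
      Algebra.FormallyUnramified.map_maximalIdeal, ← residue_eq_zero_iff, map_sub, map_sum, ← hc,
      sub_eq_zero]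
    refine Finset.sum_congr rfl fun i _ => ?_
    rw [residue_smul, ha, map_pow, pow_one]
  have hsurj : Function.Surjective (b.constr A fun i => b i ^ p) := by
    rw [← LinearMap.range_eq_top, Module.Basis.constr_range, eq_top_iff]
    exact hspan
  refine ⟨b.map (LinearEquiv.ofBijective _
    (OrzechProperty.bijective_of_surjective_endomorphism _ hsurj)), fun i => ?_⟩
  rw [Module.Basis.map_apply, LinearEquiv.ofBijective_apply, Module.Basis.constr_basis]

/-- `CRP` is stable under base change along finite étale extensions. -/
theorem IsCompleteResidualPerfection.baseChange [IsDomain A] [IsPrincipalIdealRing A]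
    {R : Type*} [CommRing R] [Algebra A R] (h : IsCompleteResidualPerfection p A R) :
    IsCompleteResidualPerfection p B (B ⊗[A] R) := by
  have := h.flat
  have := h.perfect
  have : Module.Free A B := Module.free_of_flat_of_isLocalRing
  let b := Module.Free.chooseBasis A B
  refine ⟨inferInstance, ?_, ?_⟩
  · obtain ⟨ϖ, hϖ⟩ := (IsPrincipalIdealRing.principal (maximalIdeal A)).principal
    have hR := h.complete
    -- Both completeness statements become `ϖ`-adic completeness of `A`-modules, and `B ⊗[A] R` is a
    -- finite power of `R`.
    rw [residualIdeal, IsAdicComplete.map_algebraMap_iff, hϖ] at hR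
    rw [residualIdeal_eq_of_etale A B, residualIdeal, IsAdicComplete.map_algebraMap_iff, hϖ]
    refine isAdicComplete_of_linearEquiv ?_ ϖ
      (isAdicComplete_pi (ι := Module.Free.ChooseBasisIndex A B) ϖ hR)
    exact (TensorProduct.piScalarRight A A R _).symm ≪≫ₗ
      TensorProduct.congr (LinearEquiv.refl A R) b.equivFun.symm ≪≫ₗ TensorProduct.comm A R B
  · obtain ⟨b', hb'⟩ := exists_basis_pow p b
    have hp : (p : Reduction A R) = 0 := by
      rw [← map_natCast (algebraMap A (Reduction A R))]
      refine Ideal.Quotient.eq_zero_iff_mem.2 (Ideal.mem_map_of_mem _ ?_)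
      rw [← residue_eq_zero_iff, map_natCast, CharP.cast_eq_zero]
    have : PerfectRing (Reduction A R ⊗[A] B) p :=
      perfectRing_of_basis_pow p (R := Reduction A R)
        (by rw [← map_natCast (algebraMap (Reduction A R) _), hp, map_zero])
        (Algebra.TensorProduct.basis (Reduction A R) b)
        (Algebra.TensorProduct.basis (Reduction A R) b')
        fun i => by simp [hb']
    exact perfectRing_of_ringEquiv p (reductionBaseChange A B R)

/-- Through `reductionBaseChange` this map is the base change of `reductionMap f` along the free
module `B`, so `IsFractionHom.of_basis` applies. -/
theorem isFractionHom_reductionMap_baseChange {U G : Type*} [CommRing U] [Algebra A U]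
    [CommRing G] [Algebra A G] {f : U →ₐ[A] G} (hf : IsFractionHom (reductionMap f)) :
    IsFractionHom
      (reductionMap (Algebra.TensorProduct.map (AlgHom.id B B) f : B ⊗[A] U →ₐ[B] B ⊗[A] G)) := by
  have : Module.Free A B := Module.free_of_flat_of_isLocalRing
  let b := Module.Free.chooseBasis A B
  let f' : Reduction A U →ₐ[A] Reduction A G :=
    { reductionMap f with
      commutes' := fun a => congrArg (Ideal.Quotient.mk (residualIdeal A G)) (f.commutes a) }
  let F : Reduction A U ⊗[A] B →ₐ[A] Reduction A G ⊗[A] B :=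
    Algebra.TensorProduct.map f' (AlgHom.id A B)
  have hF : IsFractionHom F.toRingHom := by
    refine hf.of_basis (Algebra.TensorProduct.basis (Reduction A U) b)
      (Algebra.TensorProduct.basis (Reduction A G) b) _ (fun r => ?_) fun i => ?_
    · exact congrArg (f' r ⊗ₜ[A] ·) (map_one (AlgHom.id A B))
    · simp [F]
  refine hF.of_ringEquiv (reductionBaseChange A B U).symm (reductionBaseChange A B G).symm
    fun x => ?_
  rw [RingEquiv.symm_apply_eq]
  obtain ⟨x, rfl⟩ := (reductionBaseChange A B U).surjective x
  rw [RingEquiv.symm_apply_apply]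
  induction x with
  | zero => simp
  | add x y hx hy => simp only [map_add, hx, hy]
  | tmul r c =>
    obtain ⟨r, rfl⟩ := Ideal.Quotient.mk_surjective r
    rfl

end FiniteEtale

/-! ### Initial objects and the comparison maps -/

theorem IsUniversalResidualPerfection.exists_algEquiv {p : ℕ} {A : Type u} [CommRing A] [IsLocalRing A]
    {U V : Type u} [CommRing U] [Algebra A U] [CommRing V] [Algebra A V]
    (hU : IsUniversalResidualPerfection p A U) (hV : IsUniversalResidualPerfection p A V) :
    Nonempty (U ≃ₐ[A] V) := by
  obtain ⟨f, -, -⟩ := hU.initial V hV.isCompleteResidualPerfection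
  obtain ⟨g, -, -⟩ := hV.initial U hU.isCompleteResidualPerfection
  exact ⟨AlgEquiv.ofAlgHom f g
    ((hV.initial V hV.isCompleteResidualPerfection).unique trivial trivial)
    ((hU.initial U hU.isCompleteResidualPerfection).unique trivial trivial)⟩

section Universal

variable {p : ℕ} [Fact p.Prime] {A B : Type u} [CommRing A] [IsDomain A] [IsLocalRing A]
  [IsPrincipalIdealRing A] [CharP (ResidueField A) p] [CommRing B] [IsLocalRing B]
  [Algebra A B] [IsLocalHom (algebraMap A B)] [Module.Finite A B] [Algebra.Etale A B]

/-- Universal residual perfections are stable under base change along finite étale extensions. -/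
theorem IsUniversalResidualPerfection.baseChange {U : Type u} [CommRing U] [Algebra A U]
    (h : IsUniversalResidualPerfection p A U) :
    IsUniversalResidualPerfection p B (B ⊗[A] U) := by
  refine ⟨h.isCompleteResidualPerfection.baseChange p, fun R _ _ hR => ?_⟩
  -- As an `A`-algebra, `R` lies in `CRP_A`; its unique map from `U` extends uniquely to `B ⊗[A] U`.
  let : Algebra A R := Algebra.compHom R (algebraMap A B)
  have : IsScalarTower A B R := IsScalarTower.of_algebraMap_eq fun _ => rfl
  obtain ⟨f, -, hf⟩ := h.initial R (hR.restrictScalars p)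
  refine ⟨baseChangeMap f, trivial, fun g _ => ?_⟩
  refine Algebra.TensorProduct.ext (by ext) (AlgHom.ext fun x => ?_)
  have := hf ((g.restrictScalars A).comp Algebra.TensorProduct.includeRight) trivial
  have := DFunLike.congr_fun this x
  simpa [baseChangeMap] using this

/-- If `B ⊗ R` and `S` are isomorphic `B`-algebras and `B`-algebra homomorphisms between them are
unique, then `A`-algebra homomorphisms `R → S` exist uniquely and induce an isomorphism. -/
theorem exists_algHom_bijective_baseChangeMap {A B R S : Type*} [CommRing A] [CommRing B]
    [Algebra A B] [CommRing R] [Algebra A R] [CommRing S] [Algebra A S] [Algebra B S]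
    [IsScalarTower A B S] (e : B ⊗[A] R ≃ₐ[B] S) (huniq : ∀ f g : B ⊗[A] R →ₐ[B] S, f = g) :
    ∃ φ : R →ₐ[A] S, (∀ ψ : R →ₐ[A] S, ψ = φ) ∧
      Function.Bijective (baseChangeMap φ : B ⊗[A] R →ₐ[B] S) := by
  refine ⟨(e.toAlgHom.restrictScalars A).comp Algebra.TensorProduct.includeRight,
    fun ψ => AlgHom.ext fun x => ?_, ?_⟩
  · have := DFunLike.congr_fun (huniq (baseChangeMap ψ) e.toAlgHom) (1 ⊗ₜ x)
    simpa [baseChangeMap] using this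
  · rw [huniq (baseChangeMap _) e.toAlgHom]
    exact e.bijective

end Universal

theorem IsGenericResidualPerfection.exists_isFractionHom {p : ℕ} {A G : Type u} [CommRing A]
    [IsLocalRing A] [CommRing G] [Algebra A G] (h : IsGenericResidualPerfection p A G) :
    ∃ (U : Type u) (_ : CommRing U) (_ : Algebra A U) (f : U →ₐ[A] G),
      IsUniversalResidualPerfection p A U ∧ IsFractionHom (reductionMap f) := by
  obtain ⟨U, _, _, f, hU, hf⟩ := h.exists_isFractionRing
  exact ⟨U, _, _, f, hU, isFractionHom_of_isFractionRing _ hf⟩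

/-- The reduction of an isomorphism of `A`-algebras. -/
def reductionEquiv {A U V : Type*} [CommRing A] [IsLocalRing A] [CommRing U] [Algebra A U]
    [CommRing V] [Algebra A V] (e : U ≃ₐ[A] V) : Reduction A U ≃+* Reduction A V :=
  RingEquiv.ofRingHom (reductionMap e.toAlgHom) (reductionMap e.symm.toAlgHom)
    (Ideal.Quotient.ringHom_ext (RingHom.ext fun x =>
      congrArg (Ideal.Quotient.mk _) (e.apply_symm_apply x)))
    (Ideal.Quotient.ringHom_ext (RingHom.ext fun x =>
      congrArg (Ideal.Quotient.mk _) (e.symm_apply_apply x)))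

theorem IsFractionHom.reductionMap_comp_algEquiv {A U V G : Type*} [CommRing A] [IsLocalRing A]
    [CommRing U] [Algebra A U] [CommRing V] [Algebra A V] [CommRing G] [Algebra A G]
    {f : V →ₐ[A] G} (hf : IsFractionHom (reductionMap f)) (e : U ≃ₐ[A] V) :
    IsFractionHom (reductionMap (f.comp e.toAlgHom)) := by
  refine hf.of_ringEquiv (reductionEquiv e) (RingEquiv.refl _) fun x => ?_
  obtain ⟨x, rfl⟩ := Ideal.Quotient.mk_surjective x
  rfl

end ResidualPerfection

open ResidualPerfection in
theorem mainTheorem8 (p : ℕ) [Fact p.Prime]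
    (A B : Type u) [CommRing A] [IsDomain A] [IsDiscreteValuationRing A]
    [CharP (IsLocalRing.ResidueField A) p]
    [CommRing B] [IsDomain B] [IsDiscreteValuationRing B]
    [Algebra A B] [IsLocalHom (algebraMap A B)] (_hinj : Function.Injective (algebraMap A B))
    [Module.Finite A B] [Algebra.Etale A B] :
    (∀ (Au Bu : Type u) [CommRing Au] [Algebra A Au] [CommRing Bu] [Algebra B Bu]
        [Algebra A Bu] [IsScalarTower A B Bu],
        ResidualPerfection.IsUniversalResidualPerfection p A Au →
        ResidualPerfection.IsUniversalResidualPerfection p B Bu →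
        ∃ φ : Au →ₐ[A] Bu, (∀ ψ : Au →ₐ[A] Bu, ψ = φ) ∧
          Function.Bijective (ResidualPerfection.baseChangeMap φ : B ⊗[A] Au →ₐ[B] Bu)) ∧
    (∀ (Ag Bg : Type u) [CommRing Ag] [Algebra A Ag] [CommRing Bg] [Algebra B Bg]
        [Algebra A Bg] [IsScalarTower A B Bg],
        ResidualPerfection.IsGenericResidualPerfection p A Ag →
        ResidualPerfection.IsGenericResidualPerfection p B Bg →
        ∃ φ : Ag →ₐ[A] Bg, (∀ ψ : Ag →ₐ[A] Bg, ψ = φ) ∧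
          Function.Bijective (ResidualPerfection.baseChangeMap φ : B ⊗[A] Ag →ₐ[B] Bg)) := by
  refine ⟨fun Au Bu _ _ _ _ _ _ hA hB => ?_, fun Ag Bg _ _ _ _ _ _ hA hB => ?_⟩
  · have hAB : IsUniversalResidualPerfection p B (B ⊗[A] Au) := hA.baseChange
    obtain ⟨e⟩ := hAB.exists_algEquiv hB
    exact exists_algHom_bijective_baseChangeMap e fun f g =>
      (hAB.initial Bu hB.isCompleteResidualPerfection).unique trivial trivial
  · obtain ⟨U, _, _, f, hU, hf⟩ := hA.exists_isFractionHom
    obtain ⟨V, _, _, g, hV, hg⟩ := hB.exists_isFractionHom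
    obtain ⟨ϖ, hirr⟩ := IsDiscreteValuationRing.exists_irreducible B
    have hϖ := hirr.maximalIdeal_eq
    have : CharP (IsLocalRing.ResidueField B) p :=
      charP_of_injective_algebraMap (algebraMap (IsLocalRing.ResidueField A) _).injective p
    have hU' : IsUniversalResidualPerfection p B (B ⊗[A] U) := hU.baseChange
    have hG : IsCompleteResidualPerfection p B (B ⊗[A] Ag) :=
      hA.isCompleteResidualPerfection.baseChange p
    have hf' := isFractionHom_reductionMap_baseChange (B := B) hf
    have hS := hB.isCompleteResidualPerfection
    -- Via `e`, both `B ⊗[A] Ag` and `Bg` have reduction the fraction ring of that of `B ⊗[A] U`.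
    obtain ⟨e⟩ := hU'.exists_algEquiv hV
    obtain ⟨k⟩ := exists_algEquiv_of_isFractionHom hirr.ne_zero hϖ hG _ hf' hS _
      (hg.reductionMap_comp_algEquiv e)
    exact exists_algHom_bijective_baseChangeMap k fun k₁ k₂ =>
      algHom_ext_of_isFractionHom hϖ hG _ hf' hS.complete
        ((hU'.initial Bg hS).unique trivial trivial)
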